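/- Let $p$ be a prime, let $q$ be a power of $p$ (with positive exponent), and let $n=\overline{n}\,p^{\nu}\ge 1$ with $p\nmid\overline{n}$ and $\nu\ge 0$. Let $\lambda\in\mathbb{F}_{q^2}^*$ have multiplicative order $r$ with $r\mid q+1$, and let $\Lambda\in\mathbb{F}_{q^2}$ be the element with $\Lambda^{p^{\nu}}=\lambda$. For a polynomial $f(x)=a_0+a_1x+\dots+a_kx^k\in\mathbb{F}_{q^2}[x]$ of degree $k$ with $a_0\ne 0$, put $f^{\dagger}(x)=a_0^{-q}\sum_{i=0}^{k}a_i^{q}x^{k-i}$, and let $B=B^{H}_{\overline{n},\lambda,q^2}$ be the sum of the degrees of all monic irreducible factors $g$ of $x^{\overline{n}}-\Lambda$ over $\mathbb{F}_{q^2}$ with $g=g^{\dagger}$. Let $M_q=\{\ell\ge 1:\ \ell\mid q^i+1\text{ for some odd positive integer }i\}$, and let $\gamma\ge 0$ be the integer such that $2^{\gamma}$ exactly divides $q+1$. For a positive integer $\ell$ coprime to $q$, let $2^{\beta(\ell)}$ be the exact power of $2$ dividing $\ell$, and write its $M_q$-factorization as $\ell=2^{\beta(\ell)}d'(\ell)d_1(\ell)$,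 where $d'(\ell)$ (respectively $d_1(\ell)$) is the product of the exact prime powers dividing $\ell$ at the odd primes not in $M_q$ (respectively in $M_q$). Then both of the following hold. \begin{enumerate} \item If $r$ is even, $\beta(\overline{n})+\beta(r)\le\gamma$ and $r\in M_q$, then $B=2^{\beta(\overline{n})}d_1(\overline{n})$. \item If $r$ is odd and $r\in M_q$, then $B=2^{\min\{\gamma,\beta(\overline{n})\}}d_1(\overline{n})$. \end{enumerate} -/

import Mathlib

namespace ConstaHull

open Polynomial

/-- The set `M_q` of all `ℓ ≥ 1` dividing `q ^ i + 1` for some odd positive integer `i`. -/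
def Mq (q : ℕ) : Set ℕ :=
  {l | 1 ≤ l ∧ ∃ i : ℕ, Odd i ∧ l ∣ q ^ i + 1}

/-- `β(ℓ)`: the exponent of `2` in the prime factorization of `ℓ`. -/
def beta (l : ℕ) : ℕ := l.factorization 2

open Classical in
/-- `d'(ℓ)`: the part of `ℓ` made of the odd primes that are not in `M_q`. -/
noncomputable def dPrime (q l : ℕ) : ℕ :=
  ∏ p ∈ l.primeFactors with p ≠ 2 ∧ p ∉ Mq q, p ^ l.factorization p

open Classical in
/-- `d₁(ℓ)`: the part of `ℓ` made of the odd primes that are in `M_q`. -/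
noncomputable def dOne (q l : ℕ) : ℕ :=
  ∏ p ∈ l.primeFactors with p ≠ 2 ∧ p ∈ Mq q, p ^ l.factorization p

/-- The `M_q`-factorization `ℓ = 2 ^ β(ℓ) * d'(ℓ) * d₁(ℓ)`. -/
theorem Mq_factorization (q : ℕ) {l : ℕ} (hl : l ≠ 0) :
    l = 2 ^ beta l * dPrime q l * dOne q l := by
  classical
  have h := Nat.prod_factorization_pow_eq_self hl
  rw [Finsupp.prod, Nat.support_factorization] at h
  have h2 : ∏ p ∈ l.primeFactors with p = 2, p ^ l.factorization p = 2 ^ beta l := by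
    rw [Finset.filter_eq']
    split_ifs with h2
    · simp [beta]
    · have : l.factorization 2 = 0 := by
        rwa [← Finsupp.notMem_support_iff, Nat.support_factorization]
      simp [beta, this]
  have h3 : (∏ p ∈ l.primeFactors with ¬ p = 2, p ^ l.factorization p)
      = dPrime q l * dOne q l := by
    rw [← Finset.prod_filter_mul_prod_filter_not _ (fun p => p ∉ Mq q)]
    simp only [Finset.filter_filter, not_not]
    congr 1
  rw [← Finset.prod_filter_mul_prod_filter_not _ (fun p => p = 2), h2, h3, ← mul_assoc] at h
  exact h.symm

variable {F : Type*} [Field F]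

/-- The conjugate-reciprocal polynomial `f† = a₀^(-q) * ∑ i ≤ k, a_i ^ q * X ^ (k - i)` of a
polynomial `f = a₀ + a₁ X + ⋯ + a_k X ^ k` of degree `k` with `a₀ ≠ 0`. -/
noncomputable def conjRec (q : ℕ) (f : F[X]) : F[X] :=
  C ((f.coeff 0 ^ q)⁻¹) *
    ∑ i ∈ Finset.range (f.natDegree + 1), C (f.coeff i ^ q) * X ^ (f.natDegree - i)

open Classical in
/-- The sum of the degrees of the self-conjugate-reciprocal polynomials among the monic irreducible
factors (listed with multiplicity) of `X ^ m - Lam`. -/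
noncomputable def BH (q m : ℕ) (Lam : F) : ℕ :=
  (((UniqueFactorizationMonoid.normalizedFactors (X ^ m - C Lam : F[X])).filter
    (fun g => g = conjRec q g)).map natDegree).sum

end ConstaHull

namespace ConstaHull

open Polynomial

/-! ### Arithmetic of `M_q` -/

/-! Write m for n̄. As p ∤ m, the roots of x^m - Λ are simple, so B counts the roots a whose minimal
polynomial g satisfies g = g†. Since g† is the minimal polynomial of a^(-q), this means that a^(-q)
is conjugate to a over F_{q²}, that is a^(-q) = a^(q^(2j)) for some j, which amounts to ord a ∈ M_q
(`minpoly_eq_conjRec_iff_Mq`).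

M_q is closed under divisors and lcm, so elements with order in M_q form a group. Hence the roots
counted are either none or a coset of the d-th roots of unity, where d = 2^min(γ, β(m)) d₁(m) is the
largest divisor of m in M_q. One such root exists because dr ∈ M_q and m/d is coprime to r
(`Mq_part_spec`, `card_filter_nthRootsFinset_Mq`). Both cases of the theorem supply these two facts.
-/

theorem Mq_of_dvd {q a b : ℕ} (hab : a ∣ b) (hb : b ∈ Mq q) : a ∈ Mq q := by
  obtain ⟨hb1, i, hi, hbi⟩ := hb
  exact ⟨Nat.pos_of_dvd_of_pos hab hb1, i, hi, hab.trans hbi⟩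

theorem add_one_dvd_pow_mul_add_one (q i : ℕ) {j : ℕ} (hj : Odd j) :
    q ^ i + 1 ∣ q ^ (i * j) + 1 := by
  simpa [pow_mul] using hj.nat_add_dvd_pow_add_pow (q ^ i) 1

theorem Mq_lcm {q a b : ℕ} (ha : a ∈ Mq q) (hb : b ∈ Mq q) : a.lcm b ∈ Mq q := by
  obtain ⟨ha1, i, hi, hai⟩ := ha
  obtain ⟨hb1, j, hj, hbj⟩ := hb
  refine ⟨Nat.lcm_pos ha1 hb1, i * j, hi.mul hj, Nat.lcm_dvd ?_ ?_⟩
  · exact hai.trans (add_one_dvd_pow_mul_add_one q i hj)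
  · exact hbj.trans (mul_comm i j ▸ add_one_dvd_pow_mul_add_one q j hi)

theorem Mq_of_dvd_add_one {q a : ℕ} (ha : a ∣ q + 1) : a ∈ Mq q :=
  ⟨Nat.pos_of_dvd_of_pos ha (by omega), 1, odd_one, by simpa using ha⟩

/-- Lifting: q^i ≡ -1 mod p gives q^(i p^k) ≡ (-1)^(p^k) = -1 mod p^(k+1), and the exponent stays
odd. -/
theorem Mq_prime_pow {q p : ℕ} (hp : p.Prime) (hp2 : p ≠ 2) (h : p ∈ Mq q) (k : ℕ) :
    p ^ k ∈ Mq q := by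
  obtain ⟨-, i, hi, hpi⟩ := h
  have hodd : Odd p := hp.odd_of_ne_two hp2
  refine ⟨Nat.pos_of_ne_zero (pow_ne_zero _ hp.ne_zero), i * p ^ k, hi.mul hodd.pow, ?_⟩
  induction k with
  | zero => simp
  | succ k ih =>
    have hdvd : (p : ℤ) ^ (k + 1) ∣ ((q : ℤ) ^ i) ^ p ^ k - (-1) ^ p ^ k := by
      have h0 : (p : ℤ) ∣ (q : ℤ) ^ i - (-1) := by
        rw [sub_neg_eq_add]; exact_mod_cast hpi
      exact dvd_sub_pow_of_dvd_sub h0 k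
    have h1 : p ^ (k + 1) ∣ q ^ (i * p ^ k) + 1 := by
      rw [(hodd.pow (n := k)).neg_one_pow, sub_neg_eq_add, ← pow_mul] at hdvd
      exact_mod_cast hdvd
    rw [pow_succ p k, ← mul_assoc]
    exact (pow_succ p k ▸ h1).trans (add_one_dvd_pow_mul_add_one q _ hodd)

/-- The unit -q mod 2^a has odd order, but the unit group is a 2-group, so -q = 1. -/
theorem two_pow_dvd_add_one_of_Mq {q a : ℕ} (h : 2 ^ a ∈ Mq q) : 2 ^ a ∣ q + 1 := by
  obtain ⟨-, i, hi, hai⟩ := h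
  rcases Nat.eq_zero_or_pos a with rfl | ha
  · simp
  have key : (-(q : ZMod (2 ^ a))) ^ i = 1 := by
    have : ((q ^ i + 1 : ℕ) : ZMod (2 ^ a)) = 0 := (ZMod.natCast_eq_zero_iff _ _).2 hai
    push_cast at this
    rw [hi.neg_pow, ← add_eq_zero_iff_neg_eq.1 this]
  have hu : IsUnit (-(q : ZMod (2 ^ a))) := IsUnit.of_pow_eq_one key hi.pos.ne'
  obtain ⟨u, hu⟩ := hu
  have h1 : u ^ i = 1 := by
    ext; rw [Units.val_pow_eq_pow_val, hu, key, Units.val_one]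
  have h2 : u ^ 2 ^ (a - 1) = 1 := by
    have := ZMod.pow_totient u
    rwa [Nat.totient_prime_pow Nat.prime_two ha, Nat.add_one_sub_one, mul_one] at this
  have h3 : orderOf u = 1 :=
    Nat.eq_one_of_dvd_coprimes
      ((Nat.coprime_two_left.2 hi).pow_left (a - 1)) (orderOf_dvd_of_pow_eq_one h2)
      (orderOf_dvd_of_pow_eq_one h1)
  rw [orderOf_eq_one_iff] at h3
  rw [h3, Units.val_one] at hu
  rw [← ZMod.natCast_eq_zero_iff]
  push_cast
  rw [hu, add_neg_cancel]

theorem Mq_of_forall_prime_pow {q N : ℕ} (hN : N ≠ 0)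
    (h : ∀ p k, p.Prime → p ^ k ∣ N → p ^ k ∈ Mq q) : N ∈ Mq q := by
  induction N using Nat.recOnPosPrimePosCoprime with
  | prime_pow p n hp hn => exact h p n hp dvd_rfl
  | zero => exact absurd rfl hN
  | one => exact Mq_of_dvd_add_one (one_dvd _)
  | coprime a b ha hb hab iha ihb =>
    rw [← hab.lcm_eq_mul]
    exact Mq_lcm (iha (by omega) fun p k hp hk => h p k hp (hk.mul_right b))
      (ihb (by omega) fun p k hp hk => h p k hp (hk.mul_left a))

theorem mem_Mq_iff {q N : ℕ} (hN : N ≠ 0) :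
    N ∈ Mq q ↔ 2 ^ beta N ∣ q + 1 ∧ ∀ p, p.Prime → p ≠ 2 → p ∣ N → p ∈ Mq q := by
  refine ⟨fun h => ⟨two_pow_dvd_add_one_of_Mq (Mq_of_dvd (Nat.ordProj_dvd N 2) h),
    fun p _ _ hpN => Mq_of_dvd hpN h⟩, fun ⟨h2, h⟩ => Mq_of_forall_prime_pow hN ?_⟩
  intro p k hp hk
  rcases eq_or_ne p 2 with rfl | hp2
  · refine Mq_of_dvd_add_one ((pow_dvd_pow 2 ?_).trans h2)
    exact (hp.pow_dvd_iff_le_factorization hN).1 hk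
  · rcases Nat.eq_zero_or_pos k with rfl | hk0
    · exact Mq_of_dvd_add_one (by simp)
    · exact Mq_prime_pow hp hp2 (h p hp hp2 ((dvd_pow_self p hk0.ne').trans hk)) k

/-! ### The largest divisor in `M_q`. -/

theorem beta_mul {a b : ℕ} (ha : a ≠ 0) (hb : b ≠ 0) : beta (a * b) = beta a + beta b := by
  rw [beta, Nat.factorization_mul ha hb, Finsupp.add_apply, beta, beta]

open Classical in
theorem factorization_dOne (q l : ℕ) :
    (dOne q l).factorization = l.factorization.filter (fun p => p ≠ 2 ∧ p ∈ Mq q) := by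
  have h : dOne q l =
      (l.factorization.filter (fun p => p ≠ 2 ∧ p ∈ Mq q)).prod (fun p k => p ^ k) := by
    rw [Finsupp.prod_filter_index, Finsupp.support_filter, Nat.support_factorization, dOne]
  rw [h]
  refine Nat.prod_pow_factorization_eq_self fun p hp => ?_
  rw [Finsupp.support_filter, Nat.support_factorization, Finset.mem_filter] at hp
  exact Nat.prime_of_mem_primeFactors hp.1

theorem dOne_ne_zero (q l : ℕ) : dOne q l ≠ 0 := by
  classical
  exact Finset.prod_ne_zero_iff.2 fun _ hp =>
    pow_ne_zero _ (Nat.prime_of_mem_primeFactors (Finset.mem_filter.1 hp).1).ne_zero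

theorem beta_dOne (q l : ℕ) : beta (dOne q l) = 0 := by
  classical
  rw [beta, factorization_dOne, Finsupp.filter_apply_neg _ _ (by simp)]

theorem Mq_of_prime_dvd_dOne {q l p : ℕ} (hp : p.Prime) (h : p ∣ dOne q l) : p ∈ Mq q := by
  classical
  by_contra hn
  have h1 := (hp.dvd_iff_one_le_factorization (dOne_ne_zero q l)).1 h
  rw [factorization_dOne, Finsupp.filter_apply_neg _ _ (by simp [hn])] at h1
  omega

theorem not_Mq_of_prime_dvd_dPrime {q l p : ℕ} (hp : p.Prime) (h : p ∣ dPrime q l) :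
    p ∉ Mq q := by
  classical
  rw [dPrime, hp.prime.dvd_finsetProd_iff] at h
  obtain ⟨s, hs, hps⟩ := h
  rw [Finset.mem_filter] at hs
  rw [(Nat.prime_dvd_prime_iff_eq hp (Nat.prime_of_mem_primeFactors hs.1)).1
    (hp.dvd_of_dvd_pow hps)]
  exact hs.2.2

theorem dvd_of_Mq_of_dvd {q γ m D : ℕ} (hm : m ≠ 0) (hγ : ¬ 2 ^ (γ + 1) ∣ q + 1)
    (hDm : D ∣ m) (hD : D ∈ Mq q) : D ∣ 2 ^ min γ (beta m) * dOne q m := by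
  classical
  have hD0 : D ≠ 0 := ne_zero_of_dvd_ne_zero hm hDm
  have hle := (Nat.factorization_le_iff_dvd hD0 hm).2 hDm
  rw [← Nat.factorization_le_iff_dvd hD0 (mul_ne_zero (by simp) (dOne_ne_zero q m)),
    Nat.factorization_mul (by simp) (dOne_ne_zero q m), Nat.prime_two.factorization_pow,
    factorization_dOne]
  intro p
  rw [Finsupp.add_apply]
  by_cases hpD : p ∣ D ∧ p.Prime
  · rcases eq_or_ne p 2 with rfl | hp2
    · have h1 : beta D ≤ γ := by
        by_contra! hlt
        exact hγ ((pow_dvd_pow 2 hlt).trans ((mem_Mq_iff hD0).1 hD).1)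
      have h2 : beta D ≤ beta m := hle 2
      rw [Finsupp.single_eq_same]
      exact (le_min h1 h2).trans (Nat.le_add_right _ _)
    · rw [Finsupp.filter_apply_pos _ _ ⟨hp2, Mq_of_dvd hpD.1 hD⟩]
      exact (hle p).trans (Nat.le_add_left _ _)
  · have : D.factorization p = 0 := by
      rw [Nat.factorization_eq_zero_iff]; tauto
    omega

/-- The largest divisor of `m` lying in `M_q` has a cofactor coprime to `r`, and its product with
`r` lies in `M_q`. -/
theorem Mq_part_spec {q γ m r : ℕ} (hm : m ≠ 0) (hr0 : r ≠ 0)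
    (hγ : 2 ^ γ ∣ q + 1) (hr : r ∈ Mq q)
    (h : Odd r ∨ beta m + beta r ≤ γ) :
    2 ^ min γ (beta m) * dOne q m * r ∈ Mq q ∧
    ∃ c, m = 2 ^ min γ (beta m) * dOne q m * c ∧ c.Coprime r := by
  have hβ : Odd r → beta r = 0 := fun h =>
    Nat.factorization_eq_zero_of_not_dvd h.not_two_dvd_nat
  constructor
  · have hpow : 2 ^ min γ (beta m) ≠ 0 := by simp
    have hd := dOne_ne_zero q m
    rw [mem_Mq_iff (mul_ne_zero (mul_ne_zero hpow hd) hr0)]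
    constructor
    · have : beta (2 ^ min γ (beta m) * dOne q m * r) = min γ (beta m) + beta r := by
        rw [beta_mul (mul_ne_zero hpow hd) hr0, beta_mul hpow hd, beta_dOne, beta,
          Nat.prime_two.factorization_pow, Finsupp.single_eq_same, add_zero]
      rw [this]
      refine (pow_dvd_pow 2 ?_).trans hγ
      rcases h with h | h
      · rw [hβ h]; omega
      · omega
    · intro p hp hp2 hpd
      rcases hp.dvd_mul.1 hpd with hpd | hpd
      · rcases hp.dvd_mul.1 hpd with hpd | hpd
        · exact absurd ((Nat.prime_dvd_prime_iff_eq hp Nat.prime_two).1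
            (hp.dvd_of_dvd_pow hpd)) hp2
        · exact Mq_of_prime_dvd_dOne hp hpd
      · exact Mq_of_dvd hpd hr
  -- Truncated subtraction: the power of 2 is trivial when β(m) ≤ γ; otherwise r must be odd.
  · refine ⟨2 ^ (beta m - γ) * dPrime q m, ?_, ?_⟩
    · conv_lhs => rw [Mq_factorization q hm]
      have : beta m = min γ (beta m) + (beta m - γ) := by omega
      conv_lhs => rw [this, pow_add]
      ring
    · refine Nat.Coprime.mul_left ?_ ?_
      · rcases h with h | h
        · exact (Nat.coprime_two_left.2 h).pow_left _
        · rw [Nat.sub_eq_zero_of_le (by omega)]; simp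
      · exact Nat.coprime_of_dvd fun p hp hpd hpr =>
          not_Mq_of_prime_dvd_dPrime hp hpd (Mq_of_dvd hpr hr)


/-! ### Conjugate-reciprocal polynomials and roots -/

section conjRec

variable {F K : Type*} [Field F] [Field K] [Algebra F K]

theorem natDegree_conjRec_le (q : ℕ) (f : F[X]) : (conjRec q f).natDegree ≤ f.natDegree := by
  refine (natDegree_C_mul_le _ _).trans (natDegree_sum_le_of_forall_le _ _ fun i _ => ?_)
  exact (natDegree_C_mul_X_pow_le _ _).trans (Nat.sub_le _ _)

theorem coeff_conjRec_natDegree {q : ℕ} {f : F[X]} (h0 : f.coeff 0 ≠ 0) :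
    (conjRec q f).coeff f.natDegree = 1 := by
  rw [conjRec, coeff_C_mul, finsetSum_coeff, Finset.sum_eq_single 0]
  · rw [coeff_C_mul_X_pow, if_pos (Nat.sub_zero _).symm, inv_mul_cancel₀ (pow_ne_zero q h0)]
  · intro i hi hi0
    rw [Finset.mem_range] at hi
    rw [coeff_C_mul_X_pow, if_neg (by omega)]
  · simp

theorem natDegree_conjRec {q : ℕ} {f : F[X]} (h0 : f.coeff 0 ≠ 0) :
    (conjRec q f).natDegree = f.natDegree :=
  (natDegree_conjRec_le q f).antisymm
    (le_natDegree_of_ne_zero (by rw [coeff_conjRec_natDegree h0]; exact one_ne_zero))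

theorem monic_conjRec {q : ℕ} {f : F[X]} (h0 : f.coeff 0 ≠ 0) : (conjRec q f).Monic := by
  rw [Monic, leadingCoeff, natDegree_conjRec h0, coeff_conjRec_natDegree h0]

/-- By additivity of Frobenius, f†(a^(-q)) = a₀^(-q) (a^(-k) f(a))^q with q = p^e and k = deg f. -/
theorem aeval_inv_pow_conjRec {p e : ℕ} [CharP F p] [hp : Fact p.Prime] (f : F[X]) {a : K}
    (ha : a ≠ 0) (hf : aeval a f = 0) : aeval (a⁻¹ ^ p ^ e) (conjRec (p ^ e) f) = 0 := by
  have : CharP K p := charP_of_injective_algebraMap (algebraMap F K).injective p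
  have key : aeval (a⁻¹ ^ p ^ e) (∑ i ∈ Finset.range (f.natDegree + 1),
      C (f.coeff i ^ p ^ e) * X ^ (f.natDegree - i)) =
      (a⁻¹ ^ f.natDegree * aeval a f) ^ p ^ e := by
    rw [aeval_eq_sum_range (p := f), Finset.mul_sum, sum_pow_char_pow, map_sum]
    refine Finset.sum_congr rfl fun i hi => ?_
    rw [Finset.mem_range] at hi
    obtain ⟨j, hj⟩ : ∃ j, f.natDegree = i + j := ⟨f.natDegree - i, by omega⟩
    rw [hj, Nat.add_sub_cancel_left]
    simp only [map_mul, aeval_C, map_pow, aeval_X, Algebra.smul_def]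
    rw [← pow_mul, mul_comm (p ^ e) j, pow_mul, ← mul_pow]
    congr 1
    rw [pow_add, inv_pow, inv_pow]
    field_simp
  rw [conjRec, map_mul, key, hf, mul_zero, zero_pow (pow_ne_zero _ hp.out.ne_zero), mul_zero]

theorem minpoly_eq_conjRec_iff {p e : ℕ} [CharP F p] [Fact p.Prime] {a : K}
    (hint : IsIntegral F a) (ha : a ≠ 0) :
    minpoly F a = conjRec (p ^ e) (minpoly F a) ↔
      aeval (a⁻¹ ^ p ^ e) (minpoly F a) = 0 := by
  have h0 : (minpoly F a).coeff 0 ≠ 0 := minpoly.coeff_zero_ne_zero hint ha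
  have hroot := aeval_inv_pow_conjRec (e := e) (minpoly F a) ha (minpoly.aeval F a)
  refine ⟨fun h => by rw [h]; exact hroot, fun h => ?_⟩
  have hmin : minpoly F a = minpoly F (a⁻¹ ^ p ^ e) :=
    minpoly.eq_of_irreducible_of_monic (minpoly.irreducible hint) h (minpoly.monic hint)
  exact (eq_of_monic_of_dvd_of_natDegree_le (minpoly.monic hint) (monic_conjRec h0)
    ((dvd_of_eq hmin).trans (minpoly.dvd F _ hroot)) (natDegree_conjRec h0).le).symm

/-- Frobenius generates the Galois group. -/
theorem aeval_minpoly_eq_zero_iff [Fintype F] [FiniteDimensional F K] {a b : K} :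
    aeval b (minpoly F a) = 0 ↔ ∃ j : ℕ, b = a ^ Fintype.card F ^ j := by
  have : Finite K := Module.finite_of_finite F
  constructor
  · intro h
    obtain ⟨σ, hσ⟩ := minpoly.exists_algEquiv_of_root (Algebra.IsAlgebraic.isAlgebraic a) h
    obtain ⟨j, hj⟩ := (FiniteField.bijective_frobeniusAlgEquivOfAlgebraic_pow F K).2 σ.symm
    refine ⟨j, ?_⟩
    rw [← σ.symm_apply_eq.2 hσ.symm, ← hj, AlgEquiv.coe_pow, FiniteField.coe_frobeniusAlgEquivOfAlgebraic_iterate]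
  · rintro ⟨j, rfl⟩
    have h := aeval_algHom_apply
      ((FiniteField.frobeniusAlgEquivOfAlgebraic F K ^ j : Gal(K/F)) : K →ₐ[F] K) a (minpoly F a)
    rw [minpoly.aeval, map_zero] at h
    rw [← h]
    congr 1
    simp [AlgEquiv.coe_pow, FiniteField.coe_frobeniusAlgEquivOfAlgebraic_iterate]

theorem exists_inv_pow_eq_iff {p e q : ℕ} [CharP K p] [Fact p.Prime] (hq : q = p ^ e) {a : K}
    (ha : a ≠ 0) (hfin : 0 < orderOf a) :
    (∃ j : ℕ, a⁻¹ ^ q = a ^ (q ^ 2) ^ j) ↔ orderOf a ∈ Mq q := by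
  have hinv : ∀ k, a⁻¹ ^ q = a ^ k ↔ a ^ (k + q) = 1 := fun k => by
    rw [pow_add, mul_eq_one_iff_eq_inv₀ (pow_ne_zero q ha), inv_pow, eq_comm]
  -- The odd exponent 2k+1 corresponds to j = k+1; the factor q is cancelled by injectivity of
  -- Frobenius. The case j = 0 gives ord a ∣ q + 1 directly.
  have hexp : ∀ k, (q ^ 2) ^ (k + 1) + q = (q ^ (2 * k + 1) + 1) * q := fun k => by ring
  simp only [hinv]
  constructor
  · rintro ⟨_ | k, hj⟩
    · exact Mq_of_dvd_add_one (orderOf_dvd_of_pow_eq_one (by rwa [pow_zero, add_comm] at hj))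
    · refine ⟨hfin, 2 * k + 1, odd_two_mul_add_one k, orderOf_dvd_of_pow_eq_one ?_⟩
      rw [hexp, pow_mul, hq] at hj
      refine iterateFrobenius_inj K p e ?_
      rw [iterateFrobenius_def, hq, hj, map_one]
  · rintro ⟨-, i, ⟨k, rfl⟩, hdvd⟩
    exact ⟨k + 1, by rw [hexp, pow_mul, orderOf_dvd_iff_pow_eq_one.1 hdvd, one_pow]⟩

theorem minpoly_eq_conjRec_iff_Mq [Fintype F] [FiniteDimensional F K] {p e q : ℕ}
    [CharP F p] [Fact p.Prime] (hq : q = p ^ e) (hF : Fintype.card F = q ^ 2) {a : K}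
    (ha : a ≠ 0) :
    minpoly F a = conjRec q (minpoly F a) ↔ orderOf a ∈ Mq q := by
  have : CharP K p := charP_of_injective_algebraMap (algebraMap F K).injective p
  have : Finite K := Module.finite_of_finite F
  have hfin : 0 < orderOf a := by
    rw [← Units.val_mk0 ha, orderOf_units]
    exact orderOf_pos _
  rw [← exists_inv_pow_eq_iff hq ha hfin, ← hF, ← aeval_minpoly_eq_zero_iff, hq,
    minpoly_eq_conjRec_iff (Algebra.IsIntegral.isIntegral a) ha]

end conjRec


/-! ### Counting roots with order in `M_q`. -/

section count

variable {F K : Type*} [Field F] [Field K] [Algebra F K]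

/-- Summing degrees over the monic irreducible factors of a split polynomial that satisfy `P` counts
the roots whose minimal polynomial satisfies `P`. -/
theorem sum_natDegree_filter_eq_card_filter_aroots (P : F[X] → Prop)
    [DecidablePred P] (s : Multiset F[X])
    (hirr : ∀ g ∈ s, Irreducible g) (hmonic : ∀ g ∈ s, g.Monic)
    (hsplits : ∀ g ∈ s, (g.map (algebraMap F K)).Splits) :
    ((s.filter P).map natDegree).sum =
      ((s.prod.aroots K).filter fun a => P (minpoly F a)).card := by
  induction s using Multiset.induction with
  | empty => simp
  | cons g s ih =>
    simp only [Multiset.mem_cons, forall_eq_or_imp] at hirr hmonic hsplits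
    have hprod : g * s.prod ≠ 0 :=
      mul_ne_zero hirr.1.ne_zero
        (Multiset.prod_ne_zero fun h0 => (hirr.2 0 h0).ne_zero rfl)
    -- All roots of g have minimal polynomial g, so they are kept or dropped together.
    have hmin : ∀ a ∈ g.aroots K, P (minpoly F a) ↔ P g := fun a ha => by
      rw [← minpoly.eq_of_irreducible_of_monic hirr.1 (mem_aroots.1 ha).2 hmonic.1]
    rw [Multiset.prod_cons, aroots_mul hprod, Multiset.filter_add, Multiset.card_add,
      ← ih hirr.2 hmonic.2 hsplits.2, Multiset.filter_congr hmin]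
    by_cases hP : P g
    · rw [Multiset.filter_cons_of_pos _ hP, Multiset.map_cons, Multiset.sum_cons,
        Multiset.filter_eq_self.2 fun _ _ => hP, ← natDegree_map (algebraMap F K),
        hsplits.1.natDegree_eq_card_roots, aroots]
    · rw [Multiset.filter_cons_of_neg _ hP, Multiset.filter_eq_nil.2 fun _ _ => hP,
        Multiset.card_zero, zero_add]

open Classical in
theorem BH_eq_card [Fintype F] [FiniteDimensional F K] {p e q m : ℕ}
    [CharP F p] [Fact p.Prime] (hq : q = p ^ e) (hF : Fintype.card F = q ^ 2)
    {Lam : F} (hLam : Lam ≠ 0) (hm : ¬ p ∣ m)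
    (hsplits : ((X ^ m - C Lam : F[X]).map (algebraMap F K)).Splits) :
    BH q m Lam = ((nthRootsFinset m (algebraMap F K Lam)).filter
      fun a => orderOf a ∈ Mq q).card := by
  have hm0 : m ≠ 0 := by rintro rfl; simp at hm
  have hmonic : (X ^ m - C Lam : F[X]).Monic := monic_X_pow_sub_C Lam hm0
  have hprod : (UniqueFactorizationMonoid.normalizedFactors (X ^ m - C Lam : F[X])).prod =
      X ^ m - C Lam := by
    rw [UniqueFactorizationMonoid.prod_normalizedFactors_eq hmonic.ne_zero,
      hmonic.normalize_eq_self]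
  have haroots : (X ^ m - C Lam : F[X]).aroots K = nthRoots m (algebraMap F K Lam) := by
    simp [aroots, nthRoots]
  have hnodup : (nthRoots m (algebraMap F K Lam)).Nodup := by
    rw [← haroots]
    exact (nodup_aroots_iff_of_splits hmonic.ne_zero hsplits).2
      (separable_X_pow_sub_C' p m Lam hm hLam)
  refine (sum_natDegree_filter_eq_card_filter_aroots (K := K) (fun g : F[X] => g = conjRec q g) _
    ?_ ?_ ?_).trans ?_
  rotate_left 3
  · rw [hprod, haroots, nthRootsFinset_def, ← Multiset.toFinset_filter, Multiset.card_toFinset,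
      Multiset.dedup_eq_self.2 (hnodup.filter _)]
    refine congrArg Multiset.card (Multiset.filter_congr fun a ha => minpoly_eq_conjRec_iff_Mq hq hF ?_)
    rintro rfl
    rw [mem_nthRoots (Nat.pos_of_ne_zero hm0), zero_pow hm0] at ha
    exact hLam ((map_eq_zero _).1 ha.symm)
  · exact fun g hg => UniqueFactorizationMonoid.irreducible_of_normalized_factor g hg
  · exact fun g hg => by
      rw [← UniqueFactorizationMonoid.normalize_normalized_factor g hg]
      exact monic_normalize (UniqueFactorizationMonoid.irreducible_of_normalized_factor g hg).ne_zero
  · exact fun g hg => hsplits.of_dvd (map_monic_ne_zero hmonic)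
      (_root_.map_dvd (mapRingHom (algebraMap F K))
        (UniqueFactorizationMonoid.dvd_of_mem_normalizedFactors hg))

open Classical in
/-- If `d ∣ m` bounds every divisor of `m` in `M_q` and `d * r ∈ M_q`, then the `m`-th roots of an
element of order `r` whose order lies in `M_q` form a coset of the group of `d`-th roots of unity. -/
theorem card_filter_nthRootsFinset_Mq {q d c r : ℕ} {ζ L : K} (hζ : IsPrimitiveRoot ζ (d * c * r))
    (hpos : 0 < d * c) (hL0 : L ≠ 0) (hL : L ^ r = 1) (hr : 0 < r) (hdr : d * r ∈ Mq q)
    (hcr : c.Coprime r) (hd : ∀ D, D ∣ d * c → D ∈ Mq q → D ∣ d) :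
    ((nthRootsFinset (d * c) L).filter fun a => orderOf a ∈ Mq q).card = d := by
  have hd0 : 0 < d := Nat.pos_of_mul_pos_right hpos
  have : NeZero d := ⟨hd0.ne'⟩
  have : NeZero r := ⟨hr.ne'⟩
  -- Base point of the coset: c is invertible modulo ord L, so L = (L^t)^c; the r-th root of unity
  -- L^t is (ζ^(dc))^s, and b = ζ^(cs).
  obtain ⟨b, hbm, hbr⟩ : ∃ b : K, b ^ (d * c) = L ∧ b ^ (d * r) = 1 := by
    obtain ⟨t, ht⟩ := exists_pow_eq_self_of_coprime
      (hcr.coprime_dvd_right (orderOf_dvd_of_pow_eq_one hL))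
    obtain ⟨s, -, hs⟩ := (hζ.pow (Nat.mul_pos hpos hr) rfl).eq_pow_of_pow_eq_one
      (ξ := L ^ t) (by rw [pow_right_comm, hL, one_pow])
    refine ⟨ζ ^ (c * s), ?_, ?_⟩
    · calc (ζ ^ (c * s)) ^ (d * c) = ((ζ ^ (d * c)) ^ s) ^ c := by ring
        _ = L := by rw [hs, pow_right_comm, ht]
    · calc (ζ ^ (c * s)) ^ (d * r) = (ζ ^ (d * c * r)) ^ s := by ring
        _ = 1 := by rw [hζ.pow_eq_one, one_pow]
  have hb0 : b ≠ 0 := by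
    rintro rfl
    rw [zero_pow hpos.ne'] at hbm
    exact hL0 hbm.symm
  have hdN : IsPrimitiveRoot (ζ ^ (c * r)) d :=
    hζ.pow (Nat.mul_pos hpos hr) (by ring)
  have hlcm : ∀ x y : K, orderOf x ∈ Mq q → orderOf y ∈ Mq q → orderOf (x * y) ∈ Mq q :=
    fun x y hx hy => Mq_of_dvd (Commute.all x y).orderOf_mul_dvd_lcm (Mq_lcm hx hy)
  have hbq : orderOf b ∈ Mq q := Mq_of_dvd (orderOf_dvd_of_pow_eq_one hbr) hdr
  have hbq' : orderOf b⁻¹ ∈ Mq q :=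
    Mq_of_dvd (orderOf_dvd_of_pow_eq_one (by rw [inv_pow, hbr, inv_one])) hdr
  refine Eq.trans ?_ hdN.card_nthRootsFinset
  refine Finset.card_bij' (fun a _ => a * b⁻¹) (fun z _ => z * b) ?_ ?_ ?_ ?_
  · intro a ha
    rw [Finset.mem_filter, mem_nthRootsFinset hpos] at ha
    rw [mem_nthRootsFinset hd0, ← orderOf_dvd_iff_pow_eq_one]
    refine hd _ (orderOf_dvd_of_pow_eq_one ?_) (hlcm _ _ ha.2 hbq')
    rw [mul_pow, inv_pow, hbm, ha.1, mul_inv_cancel₀ hL0]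
  · intro z hz
    rw [mem_nthRootsFinset hd0] at hz
    rw [Finset.mem_filter, mem_nthRootsFinset hpos]
    refine ⟨by rw [mul_pow, pow_mul, hz, one_pow, one_mul, hbm], hlcm _ _ ?_ hbq⟩
    exact Mq_of_dvd ((orderOf_dvd_of_pow_eq_one hz).trans (dvd_mul_right d r)) hdr
  · intro a _; simp [hb0]
  · intro z _; simp [hb0]

end count

/-! ### Assembly over the field of mr-th roots of unity. -/

theorem BH_eq_of_isCyclotomicExtension {F : Type*} (K : Type*) [Field F] [Fintype F] [Field K]
    [Algebra F K] {p e q m r γ : ℕ} [NeZero (m * r)]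
    [NeZero ((m * r : ℕ) : F)] [IsCyclotomicExtension {m * r} F K] [CharP F p]
    [Fact p.Prime] (hq : q = p ^ e) (hF : Fintype.card F = q ^ 2) (hm : ¬ p ∣ m)
    {Lam : F} (hr : orderOf Lam = r) (hrq : r ∣ q + 1) (hγ : 2 ^ γ ∣ q + 1)
    (hγ' : ¬ 2 ^ (γ + 1) ∣ q + 1) (h : Odd r ∨ beta m + beta r ≤ γ) :
    BH q m Lam = 2 ^ min γ (beta m) * dOne q m := by
  have hm0 : m ≠ 0 := left_ne_zero_of_mul (NeZero.ne (m * r))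
  have hr0 : r ≠ 0 := right_ne_zero_of_mul (NeZero.ne (m * r))
  have hL : Lam ^ r = 1 := hr ▸ pow_orderOf_eq_one Lam
  have hL0 : Lam ≠ 0 := by rintro rfl; simp [hr0] at hL
  obtain ⟨hdr, c, hmc, hcr⟩ := Mq_part_spec hm0 hr0 hγ (Mq_of_dvd_add_one hrq) h
  have : FiniteDimensional F K := IsCyclotomicExtension.finiteDimensional {m * r} F K
  -- Λ^r = 1 makes every root of X^m - Λ an mr-th root of unity, so K splits it.
  have hdvd : (X ^ m - C Lam : F[X]) ∣ X ^ (m * r) - 1 := by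
    have := sub_dvd_pow_sub_pow (X ^ m : F[X]) (C Lam) r
    rwa [← pow_mul, ← C_pow, hL, C_1] at this
  have hmonic : (X ^ (m * r) - 1 : F[X]).Monic := by
    simpa using monic_X_pow_sub_C (1 : F) (NeZero.ne (m * r))
  have hsplits : ((X ^ m - C Lam : F[X]).map (algebraMap F K)).Splits :=
    (IsCyclotomicExtension.splits_X_pow_sub_one F K (Set.mem_singleton (m * r))).of_dvd
      (map_monic_ne_zero hmonic) (_root_.map_dvd (mapRingHom (algebraMap F K)) hdvd)
  rw [BH_eq_card (K := K) hq hF hL0 hm hsplits]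
  have hζ := IsCyclotomicExtension.zeta_spec (m * r) F K
  generalize IsCyclotomicExtension.zeta (m * r) F K = ζ at hζ
  have hd : ∀ D, D ∣ m → D ∈ Mq q → D ∣ 2 ^ min γ (beta m) * dOne q m :=
    fun D => dvd_of_Mq_of_dvd hm0 hγ'
  generalize 2 ^ min γ (beta m) * dOne q m = d at *
  rw [hmc] at hζ hd
  have key := card_filter_nthRootsFinset_Mq (L := algebraMap F K Lam) hζ
    (hmc ▸ Nat.pos_of_ne_zero hm0) (by simpa using hL0) (by rw [← map_pow, hL, map_one])
    (Nat.pos_of_ne_zero hr0) hdr hcr hd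
  rwa [← hmc] at key

end ConstaHull

theorem proposition2 {F : Type*} [Field F] [Fintype F]
    (p e q : ℕ) (hp : p.Prime) (he : 1 ≤ e) (hq : q = p ^ e)
    (hF : Fintype.card F = q ^ 2)
    (n nbar ν : ℕ) (hn : 1 ≤ n) (hn_eq : n = nbar * p ^ ν) (hnbar : ¬ p ∣ nbar)
    (r : ℕ) (lam Lam : F) (hr : orderOf lam = r) (hrq : r ∣ q + 1)
    (hLam : Lam ^ p ^ ν = lam)
    (γ : ℕ) (hγ : 2 ^ γ ∣ q + 1) (hγ' : ¬ 2 ^ (γ + 1) ∣ q + 1) :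
    (Even r → ConstaHull.beta nbar + ConstaHull.beta r ≤ γ → r ∈ ConstaHull.Mq q →
      ConstaHull.BH q nbar Lam = 2 ^ ConstaHull.beta nbar * ConstaHull.dOne q nbar) ∧
    (Odd r → r ∈ ConstaHull.Mq q →
      ConstaHull.BH q nbar Lam =
        2 ^ min γ (ConstaHull.beta nbar) * ConstaHull.dOne q nbar) := by
  have : Fact p.Prime := ⟨hp⟩
  have hchar : CharP F p := by
    obtain ⟨p', hp'⟩ := CharP.exists F
    obtain ⟨k, hp'prime, hk⟩ := FiniteField.card F p'
    have : p ∣ p' ^ (k : ℕ) := by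
      rw [← hk, hF, hq, ← pow_mul]
      exact dvd_pow_self p (by omega)
    rwa [(Nat.prime_dvd_prime_iff_eq hp hp'prime).1 (hp.dvd_of_dvd_pow this)]
  -- λ is the image of Λ under an injective power of Frobenius.
  have horder : orderOf Lam = r := by
    rw [← hr, ← hLam, ← iterateFrobenius_def]
    exact (orderOf_injective (iterateFrobenius F p ν : F →* F) (iterateFrobenius_inj F p ν) Lam).symm
  have hpr : ¬ p ∣ r := fun hpr => by
    have h1 : p ∣ q := hq ▸ dvd_pow_self p (by omega)
    exact hp.one_lt.ne' (Nat.dvd_one.1 ((Nat.dvd_add_right h1).1 (hpr.trans hrq)))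
  have hF0 : NeZero ((nbar * r : ℕ) : F) := ⟨by
    rw [Ne, CharP.cast_eq_zero_iff F p, hp.dvd_mul]
    tauto⟩
  have : NeZero (nbar * r) := ⟨fun h => hF0.out (by rw [h, Nat.cast_zero])⟩
  have hBH := ConstaHull.BH_eq_of_isCyclotomicExtension (CyclotomicField (nbar * r) F) hq hF hnbar
    horder hrq hγ hγ'
  refine ⟨fun _ hβ _ => ?_, fun hodd _ => hBH (Or.inl hodd)⟩
  rw [hBH (Or.inr hβ), min_eq_right (by omega)]
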